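/- Let $k$ be a field and let $A$ be a finite-dimensional elementary $k$-algebra, that is, a finite-dimensional associative unital $k$-algebra such that $A/J \cong k^n$ as $k$-algebras for some natural number $n$, where $J$ is the Jacobson radical of $A$. Let $S$ be a simple left $A$-module of finite projective dimension, $\operatorname{pd}_A S < \infty$. Then $\operatorname{Ext}^1_A(S,S) = 0$. -/

import Mathlib

universe u v

/-- A `k`-algebra `A` with Jacobson radical `J` is elementary if `A / J` is isomorphic, as a
`k`-algebra, to a finite product `k × ⋯ × k` of copies of `k`. -/
def IsElementaryAlgebra (k : Type u) (A : Type v) [Field k] [Ring A] [Algebra k A] : Prop :=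
  ∃ n : ℕ, Nonempty ((A ⧸ Ring.jacobson A) ≃ₐ[k] (Fin n → k))

/-! A nonzero class in Ext¹(S, S) forces 1 = 0 in k. Such a class gives a self-extension E of S and
an element a of J acting on E as the square-zero endomorphism ε = ι ∘ p
(`IsElementaryAlgebra.exists_selfExtension`).

If Ext¹(S, N) = 0, precomposition with ε makes Hom_A(E, N) free over the dual numbers k[ε]. For an
endomorphism of N, `homTrace` is the ε-coefficient of its trace over k[ε]. It is additive on short
exact sequences of modules with this vanishing. When pd S ≤ d, Ext^{d+1}(S, -) = 0, so Ext¹(S, -)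
vanishes on every d-th cosyzygy. The signed trace there is thus additive on all finite-dimensional
modules, and so kills nilpotent endomorphisms (`cosyzygyTrace_eq_zero_of_isNilpotent`).

On a coinduced module Hom_k(A, V) the signed trace equals `homTrace` (`cosyzygyTrace_eq_homTrace`).
The endomorphism f ↦ f(a ·) is nilpotent because a is, so its trace is 0. But it acts on Hom_A(E,
Hom_k(A, V)) as ε itself, with trace dim Hom_k(S, V) (`homTrace_mulEnd`). For V = S, which is
one-dimensional, this dimension is 1. -/

open CategoryTheory CategoryTheory.Abelian

/-! ### Traces over the dual numbers, via contractions -/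

section ContractionTrace

variable {k X X' X'' : Type*} [Field k] [AddCommGroup X'] [Module k X']
  [AddCommGroup X''] [Module k X''] [AddCommGroup X] [Module k X]

/-- If `ker ε = im ε` then the differential `ε` has a contracting homotopy. -/
theorem exists_contraction (ε : Module.End k X) (hε : ε * ε = 0)
    (hex : LinearMap.ker ε ≤ LinearMap.range ε) :
    ∃ σ : Module.End k X, ε * σ + σ * ε = 1 := by
  obtain ⟨g, hg⟩ := ε.rangeRestrict.exists_rightInverse_of_surjective ε.range_rangeRestrict
  obtain ⟨τ, hτ⟩ := LinearMap.exists_extend g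
  have key : ∀ x, ε x = 0 → ε (τ x) = x := by
    intro x hx
    have hx' : x ∈ LinearMap.range ε := hex hx
    have h1 : τ x = g ⟨x, hx'⟩ := LinearMap.congr_fun hτ ⟨x, hx'⟩
    have h2 := LinearMap.congr_fun hg ⟨x, hx'⟩
    rw [h1]
    exact congrArg Subtype.val h2
  have hεε : ∀ x, ε (ε x) = 0 := fun x => LinearMap.congr_fun hε x
  -- `τ` inverts ε only on its image. D = ετ + τε commutes with ε and satisfies (D - 1)² = 0, so 2 -
  -- D is its inverse and τ(2 - D) is a contraction.
  refine ⟨τ * (2 - (ε * τ + τ * ε)), ?_⟩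
  have h1 : ε * τ * ε = ε := by
    ext x
    exact key _ (hεε x)
  have h2 : (ε * τ + τ * ε - 1) * (ε * τ + τ * ε - 1) = 0 := by
    ext x
    set y := (ε * τ + τ * ε - 1) x with hy
    have hy0 : ε y = 0 := by
      have : ε * (ε * τ + τ * ε - 1) = 0 := by
        rw [mul_sub, mul_add, ← mul_assoc, hε, ← mul_assoc, h1]; simp
      exact LinearMap.congr_fun this x
    have : (ε * τ + τ * ε - 1) y = 0 := by
      simp [hy0, key y hy0]
    exact this
  have h3 : ε * (ε * τ + τ * ε) = (ε * τ + τ * ε) * ε := by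
    rw [mul_add, add_mul, ← mul_assoc, hε, mul_assoc τ, hε, mul_assoc]; simp
  have h4 : τ * (2 - (ε * τ + τ * ε)) * ε = τ * ε * (2 - (ε * τ + τ * ε)) := by
    rw [mul_assoc, sub_mul, ← h3, mul_assoc τ ε, mul_sub ε, mul_two, two_mul]
  rw [h4, ← mul_assoc, ← add_mul]
  have h5 : (ε * τ + τ * ε) * (2 - (ε * τ + τ * ε)) =
      1 - (ε * τ + τ * ε - 1) * (ε * τ + τ * ε - 1) := by
    noncomm_ring
  rw [h5, h2, sub_zero]

open Classical in
/-- For an endomorphism `φ` of a contractible differential space `(X, ε)`, the trace of `φ ∘ σ` for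
a contraction `σ`. If `X` is viewed as a free module over the dual numbers `k[ε]`, this is the
coefficient of `ε` in the trace of `φ` over `k[ε]`. -/
noncomputable def contractionTrace (ε φ : Module.End k X) : k :=
  if h : ∃ σ : Module.End k X, ε * σ + σ * ε = 1 then LinearMap.trace k X (φ * h.choose) else 0

/-- The difference τ of two contractions anticommutes with ε. In φτ = φτεσ + φτσε the two terms have
opposite traces, by cyclicity and φε = εφ. -/
theorem contractionTrace_eq {ε φ σ : Module.End k X} (hφ : φ * ε = ε * φ)
    (hσ : ε * σ + σ * ε = 1) : contractionTrace ε φ = LinearMap.trace k X (φ * σ) := by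
  have h : ∃ σ : Module.End k X, ε * σ + σ * ε = 1 := ⟨σ, hσ⟩
  rw [contractionTrace, dif_pos h]
  set ρ := h.choose
  have hρ : ε * ρ + ρ * ε = 1 := h.choose_spec
  have hτ : ε * (ρ - σ) = -((ρ - σ) * ε) := by
    rw [mul_sub, sub_mul, eq_sub_of_add_eq hρ, eq_sub_of_add_eq hσ]; abel
  rw [← sub_eq_zero, ← map_sub, ← mul_sub]
  set τ := ρ - σ
  have h1 : φ * τ = φ * τ * ε * σ + φ * τ * σ * ε := by
    calc φ * τ = φ * τ * (ε * σ + σ * ε) := by rw [hσ, mul_one]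
      _ = _ := by noncomm_ring
  have h2 : ε * (φ * τ * σ) = -(φ * τ * ε * σ) := by
    calc ε * (φ * τ * σ) = (ε * φ) * τ * σ := by noncomm_ring
      _ = φ * (ε * τ) * σ := by rw [← hφ]; noncomm_ring
      _ = _ := by rw [hτ]; noncomm_ring
  rw [h1, map_add, LinearMap.trace_mul_comm k (φ * τ * σ) ε, h2, map_neg, add_neg_cancel]

theorem contractionTrace_zero (ε : Module.End k X) : contractionTrace ε (0 : Module.End k X) = 0 := by
  unfold contractionTrace
  split_ifs <;> simp

/-- The sequence splits compatibly with the differentials, so a contraction of X can be chosen block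
diagonal. As φ is block triangular, only its diagonal blocks enter the trace. -/
theorem contractionTrace_add_of_exact [FiniteDimensional k X] [FiniteDimensional k X']
    [FiniteDimensional k X''] {ε φ : Module.End k X} {ε' φ' : Module.End k X'}
    {ε'' φ'' : Module.End k X''} {i : X' →ₗ[k] X} {q : X →ₗ[k] X''}
    (hi : Function.Injective i) (hiq : Function.Exact i q) (hq : Function.Surjective q)
    (hεi : ε ∘ₗ i = i ∘ₗ ε') (hφi : φ ∘ₗ i = i ∘ₗ φ')
    (hεq : q ∘ₗ ε = ε'' ∘ₗ q) (hφq : q ∘ₗ φ = φ'' ∘ₗ q)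
    (hφ : φ * ε = ε * φ) (hφ' : φ' * ε' = ε' * φ') (hφ'' : φ'' * ε'' = ε'' * φ'')
    (hε : ε * ε = 0) (hε'' : ε'' * ε'' = 0)
    (hσ' : ∃ σ' : Module.End k X', ε' * σ' + σ' * ε' = 1)
    (hσ'' : ∃ σ'' : Module.End k X'', ε'' * σ'' + σ'' * ε'' = 1) :
    contractionTrace ε φ = contractionTrace ε' φ' + contractionTrace ε'' φ'' := by
  obtain ⟨σ', hσ'⟩ := hσ'
  obtain ⟨σ'', hσ''⟩ := hσ''
  obtain ⟨s₀, hs₀⟩ := q.exists_rightInverse_of_surjective (LinearMap.range_eq_top.2 hq)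
  have hεi' : ∀ x, ε (i x) = i (ε' x) := fun x => LinearMap.congr_fun hεi x
  have hφi' : ∀ x, φ (i x) = i (φ' x) := fun x => LinearMap.congr_fun hφi x
  have hεq' : ∀ x, q (ε x) = ε'' (q x) := fun x => LinearMap.congr_fun hεq x
  have hs₀' : ∀ x, q (s₀ x) = x := fun x => LinearMap.congr_fun hs₀ x
  have hεε : ∀ x, ε (ε x) = 0 := fun x => LinearMap.congr_fun hε x
  have hεε'' : ∀ x, ε'' (ε'' x) = 0 := fun x => LinearMap.congr_fun hε'' x
  have hσ₁ : ∀ x, ε' (σ' x) + σ' (ε' x) = x := fun x => LinearMap.congr_fun hσ' x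
  have hσ₂ : ∀ x, ε'' (σ'' x) + σ'' (ε'' x) = x := fun x => LinearMap.congr_fun hσ'' x
  -- Averaging the linear section `s₀` against σ'' gives a section commuting with the differentials.
  let s : X'' →ₗ[k] X := ε ∘ₗ s₀ ∘ₗ σ'' + s₀ ∘ₗ σ'' ∘ₗ ε''
  have hqs : ∀ x, q (s x) = x := by
    intro x
    simp [s, hεq', hs₀', hσ₂]
  have hεs : ∀ x, ε (s x) = s (ε'' x) := by
    intro x
    simp [s, hεε, hεε'']
  let e : X →ₗ[k] X := LinearMap.id - s ∘ₗ q
  have he : ∀ x, e x ∈ LinearMap.range i := by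
    intro x
    refine (hiq _).1 ?_
    simp [e, hqs]
  let r : X →ₗ[k] X' := (LinearEquiv.ofInjective i hi).symm.toLinearMap ∘ₗ e.codRestrict _ he
  have hir : ∀ x, i (r x) = x - s (q x) := by
    intro x
    have := (LinearEquiv.ofInjective i hi).apply_symm_apply (e.codRestrict _ he x)
    exact congrArg Subtype.val this
  have hqi : ∀ x, q (i x) = 0 := fun x => (hiq _).2 ⟨x, rfl⟩
  have hri : ∀ x, r (i x) = x := fun x => hi (by simp [hir, hqi])
  have hrε : ∀ x, r (ε x) = ε' (r x) := fun x => hi (by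
    rw [hir, ← hεi', hir, map_sub, hεs, hεq'])
  let σ : Module.End k X := i ∘ₗ σ' ∘ₗ r + s ∘ₗ σ'' ∘ₗ q
  have hσ : ε * σ + σ * ε = 1 := by
    ext x
    have h1 := congrArg i (hσ₁ (r x))
    have h2 := congrArg s (hσ₂ (q x))
    simp only [map_add] at h1 h2
    rw [hir] at h1
    simp only [σ, LinearMap.add_apply, Module.End.mul_apply, LinearMap.comp_apply, map_add,
      Module.End.one_apply, hεi', hεs, hrε, hεq']
    rw [add_add_add_comm, h1, h2, sub_add_cancel]
  rw [contractionTrace_eq hφ hσ, contractionTrace_eq hφ' hσ', contractionTrace_eq hφ'' hσ'']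
  have h1 : φ * σ = (i ∘ₗ φ' ∘ₗ σ') ∘ₗ r + (φ ∘ₗ s ∘ₗ σ'') ∘ₗ q := by
    ext x
    simp [σ, hφi']
  rw [h1, map_add, LinearMap.trace_comp_comm' r, LinearMap.trace_comp_comm' q]
  congr 2
  · ext x
    simp [hri]
  · ext x
    have := LinearMap.congr_fun hφq (s (σ'' x))
    simp only [LinearMap.comp_apply] at this
    simp [this, hqs]

end ContractionTrace

/-! ### Vanishing of Ext as lifting and extension of maps -/

section ExtModule

variable {A : Type v} [Ring A] {M M' M'' N : Type v} [AddCommGroup M] [Module A M]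
  [AddCommGroup M'] [Module A M'] [AddCommGroup M''] [Module A M''] [AddCommGroup N] [Module A N]

/-- The short complex of module categories attached to an exact pair of linear maps. -/
abbrev exactShortComplex (i : M' →ₗ[A] M) (q : M →ₗ[A] M'') (h : Function.Exact i q) :
    ShortComplex (ModuleCat.{v} A) :=
  ShortComplex.mk (ModuleCat.ofHom i) (ModuleCat.ofHom q) (by
    ext x
    exact (h _).2 ⟨x, rfl⟩)

theorem exactShortComplex_shortExact {i : M' →ₗ[A] M} {q : M →ₗ[A] M''}
    (hi : Function.Injective i) (h : Function.Exact i q) (hq : Function.Surjective q) :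
    (exactShortComplex i q h).ShortExact where
  exact := (ShortComplex.ShortExact.moduleCat_exact_iff_function_exact _).2 h
  mono_f := (ModuleCat.mono_iff_injective _).2 hi
  epi_g := (ModuleCat.epi_iff_surjective _).2 hq

theorem exists_lift_of_subsingleton_ext {i : M' →ₗ[A] M} {q : M →ₗ[A] M''}
    (hi : Function.Injective i) (h : Function.Exact i q) (hq : Function.Surjective q)
    [Subsingleton (Ext (ModuleCat.of A N) (ModuleCat.of A M') 1)] (f : N →ₗ[A] M'') :
    ∃ g : N →ₗ[A] M, q ∘ₗ g = f := by
  have hs := exactShortComplex_shortExact hi h hq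
  obtain ⟨x, hx⟩ := Ext.covariant_sequence_exact₃ (ModuleCat.of A N) hs
    (Ext.mk₀ (ModuleCat.ofHom f)) (zero_add 1) (Subsingleton.elim (α := Ext _ (ModuleCat.of A M') 1) _ _)
  obtain ⟨g, rfl⟩ := (Ext.mk₀_bijective _ _).2 x
  rw [Ext.mk₀_comp_mk₀] at hx
  refine ⟨g.hom, ?_⟩
  exact congrArg ModuleCat.Hom.hom ((Ext.mk₀_bijective _ _).1 hx)

theorem exists_extension_of_subsingleton_ext {i : M' →ₗ[A] M} {q : M →ₗ[A] M''}
    (hi : Function.Injective i) (h : Function.Exact i q) (hq : Function.Surjective q)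
    [Subsingleton (Ext (ModuleCat.of A M'') (ModuleCat.of A N) 1)] (f : M' →ₗ[A] N) :
    ∃ g : M →ₗ[A] N, g ∘ₗ i = f := by
  have hs := exactShortComplex_shortExact hi h hq
  obtain ⟨x, hx⟩ := Ext.contravariant_sequence_exact₁ hs (ModuleCat.of A N)
    (Ext.mk₀ (ModuleCat.ofHom f)) (add_zero 1) (Subsingleton.elim (α := Ext (ModuleCat.of A M'') _ 1) _ _)
  obtain ⟨g, rfl⟩ := (Ext.mk₀_bijective _ _).2 x
  rw [Ext.mk₀_comp_mk₀] at hx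
  refine ⟨g.hom, ?_⟩
  exact congrArg ModuleCat.Hom.hom ((Ext.mk₀_bijective _ _).1 hx)

theorem subsingleton_ext_of_exact {i : M' →ₗ[A] M} {q : M →ₗ[A] M''}
    (hi : Function.Injective i) (h : Function.Exact i q) (hq : Function.Surjective q) (n : ℕ)
    [Subsingleton (Ext (ModuleCat.of A M') (ModuleCat.of A N) n)]
    [Subsingleton (Ext (ModuleCat.of A M'') (ModuleCat.of A N) n)] :
    Subsingleton (Ext (ModuleCat.of A M) (ModuleCat.of A N) n) := by
  have hs := exactShortComplex_shortExact hi h hq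
  refine subsingleton_of_forall_eq 0 fun x => ?_
  obtain ⟨y, hy⟩ := Ext.contravariant_sequence_exact₂ hs (ModuleCat.of A N) x
    (Subsingleton.elim (α := Ext (ModuleCat.of A M') _ n) _ _)
  rw [← hy, Subsingleton.elim (α := Ext (ModuleCat.of A M'') _ n) y 0, Ext.comp_zero]

theorem subsingleton_ext_of_exact_shift {i : M' →ₗ[A] M} {q : M →ₗ[A] M''}
    (hi : Function.Injective i) (h : Function.Exact i q) (hq : Function.Surjective q) (n : ℕ)
    [Subsingleton (Ext (ModuleCat.of A N) (ModuleCat.of A M) n)]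
    [Subsingleton (Ext (ModuleCat.of A N) (ModuleCat.of A M') (n + 1))] :
    Subsingleton (Ext (ModuleCat.of A N) (ModuleCat.of A M'') n) := by
  have hs := exactShortComplex_shortExact hi h hq
  refine subsingleton_of_forall_eq 0 fun x => ?_
  obtain ⟨y, hy⟩ := Ext.covariant_sequence_exact₃ (ModuleCat.of A N) hs x rfl
    (Subsingleton.elim (α := Ext _ (ModuleCat.of A M') (n + 1)) _ _)
  rw [← hy, Subsingleton.elim (α := Ext _ (ModuleCat.of A M) n) y 0, Ext.zero_comp]

/-- `Ext¹(M'', N)` vanishes if every map to `N` from the kernel of a projective presentation of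
`M''` extends. -/
theorem subsingleton_ext_one_of_forall_extension {i : M' →ₗ[A] M} {q : M →ₗ[A] M''}
    (hi : Function.Injective i) (h : Function.Exact i q) (hq : Function.Surjective q)
    [Module.Projective A M] (H : ∀ f : M' →ₗ[A] N, ∃ g : M →ₗ[A] N, g ∘ₗ i = f) :
    Subsingleton (Ext (ModuleCat.of A M'') (ModuleCat.of A N) 1) := by
  have hs := exactShortComplex_shortExact hi h hq
  refine subsingleton_of_forall_eq 0 fun x => ?_
  have : Projective (ModuleCat.of A M) := (IsProjective.iff_projective M).1 inferInstance
  obtain ⟨y, hy⟩ := Ext.contravariant_sequence_exact₃ hs (ModuleCat.of A N) x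
    (Ext.eq_zero_of_projective (P := ModuleCat.of A M) _) (add_zero 1)
  obtain ⟨f, rfl⟩ := (Ext.mk₀_bijective _ _).2 y
  obtain ⟨g, hg⟩ := H f.hom
  have hf : f = (exactShortComplex i q h).f ≫ ModuleCat.ofHom g := by
    ext x
    exact (LinearMap.congr_fun hg x).symm
  rw [← hy, hf, ← Ext.mk₀_comp_mk₀, hs.extClass_comp_assoc]

end ExtModule

/-! ### Hom spaces over A as k-vector spaces -/

section HomSpaces

variable (k : Type u) [Field k] {A : Type v} [Ring A] [Algebra k A]
  {M M' N N' : Type v} [AddCommGroup M] [Module A M] [AddCommGroup M'] [Module A M']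
  [AddCommGroup N'] [Module k N'] [Module A N'] [IsScalarTower k A N']
  [AddCommGroup N] [Module k N] [Module A N] [IsScalarTower k A N]

/-- Precomposition with an `A`-linear map, as a `k`-linear map. -/
def homPrecomp (N : Type v) [AddCommGroup N] [Module k N] [Module A N] [IsScalarTower k A N]
    (g : M →ₗ[A] M') : (M' →ₗ[A] N) →ₗ[k] (M →ₗ[A] N) where
  toFun h := h ∘ₗ g
  map_add' _ _ := rfl
  map_smul' _ _ := rfl

/-- Postcomposition with an `A`-linear map, as a `k`-linear map. -/
def homPostcomp (M : Type v) [AddCommGroup M] [Module A M] (φ : N →ₗ[A] N') :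
    (M →ₗ[A] N) →ₗ[k] (M →ₗ[A] N') where
  toFun h := φ ∘ₗ h
  map_add' _ _ := LinearMap.comp_add _ _ _
  map_smul' c h := by
    ext x
    change φ (c • h x) = c • φ (h x)
    rw [← algebraMap_smul A c (h x), map_smul, algebraMap_smul]

@[simp]
theorem homPrecomp_apply (g : M →ₗ[A] M') (h : M' →ₗ[A] N) : homPrecomp k N g h = h ∘ₗ g := rfl

@[simp]
theorem homPostcomp_apply (φ : N →ₗ[A] N') (h : M →ₗ[A] N) : homPostcomp k M φ h = φ ∘ₗ h := rfl

theorem finiteDimensional_hom [Module k M] [IsScalarTower k A M] [FiniteDimensional k M]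
    [FiniteDimensional k N] : FiniteDimensional k (M →ₗ[A] N) :=
  Module.Finite.of_injective (LinearMap.restrictScalarsₗ k A M N k)
    (LinearMap.restrictScalars_injective k)

end HomSpaces

/-! ### Coinduced modules -/

section Coinduction

/-- The left `A`-module `Hom_k(A, V)` coinduced from a `k`-vector space `V`. -/
def CoindModule (k : Type u) (A : Type v) (V : Type v) [Field k] [Ring A] [Algebra k A]
    [AddCommGroup V] [Module k V] : Type v :=
  A →ₗ[k] V

variable (k : Type u) [Field k] (A : Type v) [Ring A] [Algebra k A]
  (V : Type v) [AddCommGroup V] [Module k V]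

namespace CoindModule

noncomputable instance : AddCommGroup (CoindModule k A V) :=
  inferInstanceAs (AddCommGroup (A →ₗ[k] V))

noncomputable instance : Module k (CoindModule k A V) :=
  inferInstanceAs (Module k (A →ₗ[k] V))

instance : FunLike (CoindModule k A V) A V :=
  inferInstanceAs (FunLike (A →ₗ[k] V) A V)

instance : LinearMapClass (CoindModule k A V) k A V :=
  inferInstanceAs (LinearMapClass (A →ₗ[k] V) k A V)

instance [FiniteDimensional k A] [FiniteDimensional k V] :
    FiniteDimensional k (CoindModule k A V) :=
  inferInstanceAs (FiniteDimensional k (A →ₗ[k] V))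

variable {k A V}

@[ext]
theorem ext {f g : CoindModule k A V} (h : ∀ x, f x = g x) : f = g :=
  DFunLike.ext f g h

/-- The element of the coinduced module given by a linear map. -/
def mk (f : A →ₗ[k] V) : CoindModule k A V := f

@[simp] theorem mk_apply (f : A →ₗ[k] V) (x : A) : mk f x = f x := rfl

@[simp] theorem add_apply (f g : CoindModule k A V) (x : A) : (f + g) x = f x + g x := rfl

@[simp] theorem zero_apply (x : A) : (0 : CoindModule k A V) x = 0 := rfl

@[simp] theorem smul_apply (c : k) (f : CoindModule k A V) (x : A) : (c • f) x = c • f x := rfl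

noncomputable instance : SMul A (CoindModule k A V) where
  smul a f := LinearMap.comp (show A →ₗ[k] V from f) (LinearMap.mulRight k a)

@[simp] theorem ring_smul_apply (a : A) (f : CoindModule k A V) (x : A) :
    (a • f) x = f (x * a) := rfl

noncomputable instance : Module A (CoindModule k A V) where
  one_smul f := by ext; simp
  mul_smul a b f := by ext; simp [mul_assoc]
  smul_zero a := by ext; simp
  smul_add a f g := by ext; simp
  add_smul a b f := by ext; simp [mul_add]
  zero_smul f := by ext; simp

instance : IsScalarTower k A (CoindModule k A V) where
  smul_assoc c a f := by ext; simp

/-- Functoriality of coinduction. -/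
def map {W : Type v} [AddCommGroup W] [Module k W] (ψ : V →ₗ[k] W) :
    CoindModule k A V →ₗ[A] CoindModule k A W where
  toFun f := mk (ψ ∘ₗ (show A →ₗ[k] V from f))
  map_add' f g := by ext; simp; exact map_add ψ _ _
  map_smul' a f := rfl

@[simp] theorem map_apply {W : Type v} [AddCommGroup W] [Module k W] (ψ : V →ₗ[k] W)
    (f : CoindModule k A V) (x : A) : map ψ f x = ψ (f x) := rfl

/-- The endomorphism `f ↦ f (a * ·)` of the coinduced module. -/
def mulEnd (a : A) : CoindModule k A V →ₗ[A] CoindModule k A V where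
  toFun f := mk ((show A →ₗ[k] V from f) ∘ₗ LinearMap.mulLeft k a)
  map_add' f g := rfl
  map_smul' b f := by
    ext x
    exact congrArg f (mul_assoc a x b)

@[simp] theorem mulEnd_apply (a : A) (f : CoindModule k A V) (x : A) :
    mulEnd a f x = f (a * x) := rfl

theorem mulEnd_pow (a : A) (n : ℕ) (f : CoindModule k A V) (x : A) :
    ((mulEnd a : Module.End A (CoindModule k A V)) ^ n) f x = f (a ^ n * x) := by
  induction n generalizing f with
  | zero => simp
  | succ n ih => rw [pow_succ, Module.End.mul_apply, ih, mulEnd_apply, ← mul_assoc, ← pow_succ']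

theorem isNilpotent_mulEnd {a : A} (ha : IsNilpotent a) :
    IsNilpotent (mulEnd a : Module.End A (CoindModule k A V)) := by
  obtain ⟨n, hn⟩ := ha
  refine ⟨n, ?_⟩
  ext f x
  rw [mulEnd_pow, hn]
  simp

/-- The adjunction between restriction of scalars and coinduction. -/
noncomputable def homEquiv (M : Type v) [AddCommGroup M] [Module k M] [Module A M] [IsScalarTower k A M] :
    (M →ₗ[A] CoindModule k A V) ≃ₗ[k] (M →ₗ[k] V) where
  toFun h :=
    { toFun := fun m => h m 1
      map_add' := by simp
      map_smul' := fun c m => by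
        rw [← algebraMap_smul A c m, map_smul, algebraMap_smul]; rfl }
  map_add' _ _ := rfl
  map_smul' _ _ := rfl
  invFun g :=
    { toFun := fun m => mk (g ∘ₗ (LinearMap.toSpanSingleton A M m).restrictScalars k)
      map_add' := fun m n => by ext; simp
      map_smul' := fun a m => by ext; simp [mul_smul] }
  left_inv h := by
    ext m x
    change h (x • m) 1 = h m x
    simp
  right_inv g := by
    ext m
    simp

@[simp] theorem homEquiv_apply (M : Type v) [AddCommGroup M] [Module k M] [Module A M]
    [IsScalarTower k A M] (h : M →ₗ[A] CoindModule k A V) (m : M) :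
    homEquiv M h m = h m 1 := rfl

/-- By adjunction, Baer's criterion becomes extension of k-linear maps from a subspace. -/
theorem injective : Module.Injective A (CoindModule k A V) := by
  refine Module.Baer.injective fun I g => ?_
  obtain ⟨G, hG⟩ := LinearMap.exists_extend (p := I.restrictScalars k)
    (homEquiv (k := k) (V := V) I g)
  refine ⟨(homEquiv A).symm G, fun x hx => ?_⟩
  ext y
  have h1 := LinearMap.congr_fun hG ⟨y * x, I.mul_mem_left y hx⟩
  have h2 : g ⟨y * x, I.mul_mem_left y hx⟩ = y • g ⟨x, hx⟩ := by
    rw [← map_smul]; rfl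
  have h3 : G (y * x) = g ⟨y * x, I.mul_mem_left y hx⟩ 1 := h1
  rw [h2, ring_smul_apply, one_mul] at h3
  exact h3

theorem subsingleton_ext (M : Type v) [AddCommGroup M] [Module A M] (n : ℕ) :
    Subsingleton (Ext (ModuleCat.of A M) (ModuleCat.of A (CoindModule k A V)) (n + 1)) := by
  have := injective (k := k) (A := A) (V := V)
  have : Injective (ModuleCat.of A (CoindModule k A V)) :=
    Module.injective_object_of_injective_module A _
  exact subsingleton_of_forall_eq 0 fun x => Ext.eq_zero_of_injective x

variable (k A)
variable (N : Type v) [AddCommGroup N] [Module k N] [Module A N] [IsScalarTower k A N]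

/-- The embedding of a module in the coinduced module. -/
noncomputable def unit : N →ₗ[A] CoindModule k A N := (homEquiv N).symm LinearMap.id

variable {N}

@[simp] theorem unit_apply (n : N) (x : A) : unit k A N n x = x • n := rfl

theorem unit_injective : Function.Injective (unit k A N) := fun m n h => by
  have := congrArg (fun f : CoindModule k A N => f 1) h
  simpa using this

end CoindModule

/-! ### Cosyzygies as an exact functor -/

/-- The cokernel of the embedding of `N` in the coinduced module. -/
abbrev Cosyzygy (N : Type v) [AddCommGroup N] [Module k N] [Module A N] [IsScalarTower k A N] :
    Type v :=
  CoindModule k A N ⧸ LinearMap.range (CoindModule.unit k A N)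

namespace Cosyzygy

variable (N : Type v) [AddCommGroup N] [Module k N] [Module A N] [IsScalarTower k A N]
variable {N' N'' : Type v} [AddCommGroup N'] [Module k N'] [Module A N'] [IsScalarTower k A N']
  [AddCommGroup N''] [Module k N''] [Module A N''] [IsScalarTower k A N'']

instance [FiniteDimensional k A] [FiniteDimensional k N] :
    FiniteDimensional k (Cosyzygy k A N) :=
  Module.Finite.quotient k _

theorem exact : Function.Exact (CoindModule.unit k A N)
    (LinearMap.range (CoindModule.unit k A N)).mkQ :=
  LinearMap.exact_map_mkQ_range _

variable {A N}

/-- Functoriality of the cosyzygy. -/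
noncomputable def map (φ : N →ₗ[A] N') : Cosyzygy k A N →ₗ[A] Cosyzygy k A N' :=
  Submodule.mapQ _ _ (CoindModule.map (φ.restrictScalars k)) (by
    rintro _ ⟨n, rfl⟩
    refine ⟨φ n, ?_⟩
    ext x
    simp)

@[simp] theorem map_mkQ (φ : N →ₗ[A] N') (f : CoindModule k A N) :
    map k φ (Submodule.Quotient.mk f) =
      Submodule.Quotient.mk (CoindModule.map (φ.restrictScalars k) f) := rfl

theorem map_comp (ψ : N' →ₗ[A] N'') (φ : N →ₗ[A] N') :
    map k (ψ ∘ₗ φ) = map k ψ ∘ₗ map k φ := by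
  ext x
  rfl

theorem map_zero : map k (0 : N →ₗ[A] N') = 0 := by
  ext x
  change map k (0 : N →ₗ[A] N') (Submodule.Quotient.mk x) = 0
  rw [map_mkQ, Submodule.Quotient.mk_eq_zero]
  exact ⟨0, by ext; simp⟩

theorem map_injective {i : N →ₗ[A] N'} (hi : Function.Injective i) :
    Function.Injective (map k i) := by
  rw [injective_iff_map_eq_zero]
  intro x hx
  obtain ⟨f, rfl⟩ := Submodule.Quotient.mk_surjective _ x
  rw [map_mkQ, Submodule.Quotient.mk_eq_zero] at hx
  obtain ⟨n', hn'⟩ := hx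
  have hn'x : ∀ x : A, x • n' = i (f x) := fun x => congrArg (fun g : CoindModule k A N' => g x) hn'
  have hn1 : n' = i (f 1) := by simpa using hn'x 1
  rw [Submodule.Quotient.mk_eq_zero]
  refine ⟨f 1, ?_⟩
  ext x
  refine hi ?_
  rw [CoindModule.unit_apply, map_smul, ← hn1, hn'x]

theorem map_surjective {q : N' →ₗ[A] N''} (hq : Function.Surjective q) :
    Function.Surjective (map k q) := by
  obtain ⟨s, hs⟩ := (q.restrictScalars k).exists_rightInverse_of_surjective
    (LinearMap.range_eq_top.2 hq)
  intro x
  obtain ⟨f, rfl⟩ := Submodule.Quotient.mk_surjective _ x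
  refine ⟨Submodule.Quotient.mk (CoindModule.map s f), ?_⟩
  rw [map_mkQ]
  congr 1
  ext x
  exact LinearMap.congr_fun hs (f x)

theorem map_exact {i : N →ₗ[A] N'} {q : N' →ₗ[A] N''} (hi : Function.Injective i)
    (h : Function.Exact i q) (hq : Function.Surjective q) :
    Function.Exact (map k i) (map k q) := by
  intro x
  constructor
  · intro hx
    obtain ⟨f, rfl⟩ := Submodule.Quotient.mk_surjective _ x
    rw [map_mkQ, Submodule.Quotient.mk_eq_zero] at hx
    obtain ⟨n'', hn''⟩ := hx
    obtain ⟨n', rfl⟩ := hq n''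
    have hx : ∀ x : A, x • q n' = q (f x) :=
      fun x => congrArg (fun g : CoindModule k A N'' => g x) hn''
    -- Subtracting the image of n' under the unit leaves the class of f unchanged and makes its
    -- values land in the image of i.
    have hmem : ∀ x : A, f x - x • n' ∈ LinearMap.range (i.restrictScalars k) := fun x =>
      (h _).1 (by rw [map_sub, map_smul, hx, sub_self])
    let g₀ : A →ₗ[k] N' :=
      (show A →ₗ[k] N' from f) - (LinearMap.toSpanSingleton A N' n').restrictScalars k
    let g : A →ₗ[k] N := (LinearEquiv.ofInjective (i.restrictScalars k) hi).symm.toLinearMap ∘ₗ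
      g₀.codRestrict (LinearMap.range (i.restrictScalars k)) hmem
    have hg : ∀ x, i (g x) = f x - x • n' := fun x =>
      congrArg Subtype.val ((LinearEquiv.ofInjective (i.restrictScalars k) hi).apply_symm_apply
        (g₀.codRestrict (LinearMap.range (i.restrictScalars k)) hmem x))
    refine ⟨Submodule.Quotient.mk (CoindModule.mk g), ?_⟩
    rw [map_mkQ, Submodule.Quotient.eq]
    refine ⟨-n', ?_⟩
    ext x
    change x • -n' = i (g x) - f x
    rw [hg, smul_neg]
    abel
  · rintro ⟨y, rfl⟩
    have : q ∘ₗ i = 0 := LinearMap.ext fun n => (h _).2 ⟨n, rfl⟩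
    rw [← LinearMap.comp_apply, ← map_comp, this, map_zero, LinearMap.zero_apply]

end Cosyzygy

end Coinduction

/-! ### Self-extensions and the trace on Hom(E, N) -/

/-- A short exact sequence `0 → S → E → S → 0` of modules. -/
structure SelfExtension (A S E : Type v) [Ring A] [AddCommGroup S] [Module A S]
    [AddCommGroup E] [Module A E] where
  /-- The inclusion. -/
  ι : S →ₗ[A] E
  /-- The projection. -/
  p : E →ₗ[A] S
  ι_injective : Function.Injective ι
  exact : Function.Exact ι p
  p_surjective : Function.Surjective p

namespace SelfExtension

variable (k : Type u) [Field k] {A : Type v} [Ring A] [Algebra k A]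
  {S E : Type v} [AddCommGroup S] [Module A S] [AddCommGroup E] [Module A E]
  (X : SelfExtension A S E)
  (N : Type v) {N' N'' : Type v} [AddCommGroup N] [Module k N] [Module A N] [IsScalarTower k A N]
  [AddCommGroup N'] [Module k N'] [Module A N'] [IsScalarTower k A N']
  [AddCommGroup N''] [Module k N''] [Module A N''] [IsScalarTower k A N'']

theorem p_ι (s : S) : X.p (X.ι s) = 0 := (X.exact _).2 ⟨s, rfl⟩

/-- The square-zero endomorphism of the middle term of a self-extension. -/
def nilEnd : E →ₗ[A] E := X.ι ∘ₗ X.p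

theorem homPrecomp_nilEnd_mul_self :
    (homPrecomp k N X.nilEnd : Module.End k (E →ₗ[A] N)) * homPrecomp k N X.nilEnd = 0 := by
  ext h e
  simp [nilEnd, p_ι]

variable {N}

theorem commute_homPostcomp (φ : N →ₗ[A] N) :
    (homPostcomp k E φ : Module.End k (E →ₗ[A] N)) * homPrecomp k N X.nilEnd =
      homPrecomp k N X.nilEnd * homPostcomp k E φ := rfl

/-- A map h with hε = 0 vanishes on the image of ι, so h = h'p. Extending h' along ι to g gives h =
gιp = gε, so kernel equals image. -/
theorem exists_contraction_hom [Subsingleton (Ext (ModuleCat.of A S) (ModuleCat.of A N) 1)] :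
    ∃ σ : Module.End k (E →ₗ[A] N),
      homPrecomp k N X.nilEnd * σ + σ * homPrecomp k N X.nilEnd = 1 := by
  refine exists_contraction _ (X.homPrecomp_nilEnd_mul_self k N) fun h hh => ?_
  have hh' : ∀ s, h (X.ι s) = 0 := by
    intro s
    obtain ⟨e, rfl⟩ := X.p_surjective s
    exact LinearMap.congr_fun hh e
  have hker : LinearMap.ker X.p ≤ LinearMap.ker h := by
    intro e he
    obtain ⟨s, rfl⟩ := (X.exact e).1 he
    exact hh' s
  obtain ⟨h', hh''⟩ : ∃ h' : S →ₗ[A] N, h' ∘ₗ X.p = h :=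
    ⟨(LinearMap.ker X.p).liftQ h hker ∘ₗ
      (X.p.quotKerEquivOfSurjective X.p_surjective).symm.toLinearMap, by
      ext e
      have : (X.p.quotKerEquivOfSurjective X.p_surjective).symm (X.p e) =
          Submodule.Quotient.mk e := by
        rw [LinearEquiv.symm_apply_eq]; rfl
      simp [this]⟩
  obtain ⟨g, hg⟩ := exists_extension_of_subsingleton_ext X.ι_injective X.exact X.p_surjective h'
  refine ⟨g, ?_⟩
  rw [← hh'', ← hg]
  rfl

/-- The trace of an endomorphism of `N` on `Hom_A(E, N)`, relative to the square-zero endomorphism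
of `E`. -/
noncomputable def homTrace (φ : N →ₗ[A] N) : k :=
  contractionTrace (homPrecomp k N X.nilEnd) (homPostcomp k E φ)

theorem homTrace_zero : X.homTrace k (0 : N →ₗ[A] N) = 0 := by
  have : homPostcomp k E (0 : N →ₗ[A] N) = 0 := by
    ext h e
    simp
  rw [homTrace, this, contractionTrace_zero]

variable [Module k E] [IsScalarTower k A E] [FiniteDimensional k E]

theorem homTrace_add_of_exact [FiniteDimensional k N] [FiniteDimensional k N']
    [FiniteDimensional k N''] {i : N' →ₗ[A] N} {q : N →ₗ[A] N''}
    (hi : Function.Injective i) (h : Function.Exact i q) (hq : Function.Surjective q)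
    [hN' : Subsingleton (Ext (ModuleCat.of A S) (ModuleCat.of A N') 1)]
    [Subsingleton (Ext (ModuleCat.of A S) (ModuleCat.of A N'') 1)]
    {φ' : N' →ₗ[A] N'} {φ : N →ₗ[A] N} {φ'' : N'' →ₗ[A] N''}
    (hφi : φ ∘ₗ i = i ∘ₗ φ') (hφq : q ∘ₗ φ = φ'' ∘ₗ q) :
    X.homTrace k φ = X.homTrace k φ' + X.homTrace k φ'' := by
  have := finiteDimensional_hom k (A := A) (M := E) (N := N)
  have := finiteDimensional_hom k (A := A) (M := E) (N := N')
  have := finiteDimensional_hom k (A := A) (M := E) (N := N'')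
  -- Needed for surjectivity of Hom(E, N) → Hom(E, N'').
  have : Subsingleton (Ext (ModuleCat.of A E) (ModuleCat.of A N') 1) :=
    subsingleton_ext_of_exact X.ι_injective X.exact X.p_surjective 1
  refine contractionTrace_add_of_exact (i := homPostcomp k E i) (q := homPostcomp k E q)
    ?_ ?_ ?_ rfl ?_ rfl ?_ (X.commute_homPostcomp k φ) (X.commute_homPostcomp k φ')
    (X.commute_homPostcomp k φ'') (X.homPrecomp_nilEnd_mul_self k N)
    (X.homPrecomp_nilEnd_mul_self k N'') (X.exists_contraction_hom k) (X.exists_contraction_hom k)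
  · intro f g hfg
    ext e
    exact hi (LinearMap.congr_fun hfg e)
  · intro f
    constructor
    · intro hf
      have hmem : ∀ e, f e ∈ LinearMap.range i := fun e => (h _).1 (LinearMap.congr_fun hf e)
      refine ⟨(LinearEquiv.ofInjective i hi).symm.toLinearMap ∘ₗ f.codRestrict _ hmem, ?_⟩
      ext e
      exact congrArg Subtype.val
        ((LinearEquiv.ofInjective i hi).apply_symm_apply (f.codRestrict _ hmem e))
    · rintro ⟨g, rfl⟩
      ext e
      exact (h _).2 ⟨g e, rfl⟩
  · exact fun f => exists_lift_of_subsingleton_ext hi h hq f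
  · ext f e
    exact LinearMap.congr_fun hφi (f e)
  · ext f e
    exact LinearMap.congr_fun hφq (f e)

variable [Module k S] [IsScalarTower k A S]
variable {V : Type v} [AddCommGroup V] [Module k V] [FiniteDimensional k V]

/-- Here Hom_A(E, N) is Hom_k(E, V), and a k-linear splitting E = S ⊕ S, with section g and
retraction r, gives the contraction h ↦ hgr. Postcomposition with ψ respects the splitting, so it
has no ε-coefficient: cyclicity leaves f ↦ ψfrg, and rg = 0. -/
theorem homTrace_coindModule_map [FiniteDimensional k A] (ψ : V →ₗ[k] V) :
    X.homTrace k (CoindModule.map (A := A) ψ) = 0 := by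
  have hSfin : FiniteDimensional k S :=
    Module.Finite.of_injective (X.ι.restrictScalars k) X.ι_injective
  obtain ⟨g, hg⟩ := (X.p.restrictScalars k).exists_rightInverse_of_surjective
    (LinearMap.range_eq_top.2 X.p_surjective)
  have hpg : ∀ s, X.p (g s) = s := fun s => LinearMap.congr_fun hg s
  let ι' := X.ι.restrictScalars k
  let e₀ : E →ₗ[k] E := LinearMap.id - g ∘ₗ X.p.restrictScalars k
  have hmem : ∀ e, e₀ e ∈ LinearMap.range ι' := fun e =>
    (X.exact _).1 (by simp [e₀, hpg])
  let r : E →ₗ[k] S := (LinearEquiv.ofInjective ι' X.ι_injective).symm.toLinearMap ∘ₗ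
    e₀.codRestrict _ hmem
  have hιr : ∀ e, X.ι (r e) = e - g (X.p e) := fun e => congrArg Subtype.val
    ((LinearEquiv.ofInjective ι' X.ι_injective).apply_symm_apply (e₀.codRestrict _ hmem e))
  have hrι : ∀ s, r (X.ι s) = s := fun s => X.ι_injective (by simp [hιr, p_ι])
  have hrg : ∀ s, r (g s) = 0 := fun s => X.ι_injective (by simp [hιr, hpg])
  let L := CoindModule.homEquiv (k := k) (A := A) (V := V) E
  let α : (S →ₗ[k] V) →ₗ[k] (E →ₗ[A] CoindModule k A V) :=
    L.symm.toLinearMap ∘ₗ LinearMap.lcomp k V r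
  let β : (E →ₗ[A] CoindModule k A V) →ₗ[k] (S →ₗ[k] V) :=
    LinearMap.lcomp k V g ∘ₗ L.toLinearMap
  have hL : ∀ h : E →ₗ[k] V, ∀ e, L.symm h e 1 = h e := fun h e =>
    LinearMap.congr_fun (L.apply_symm_apply h) e
  have hσ : (homPrecomp k (CoindModule k A V) X.nilEnd) * (α ∘ₗ β) +
      (α ∘ₗ β) * (homPrecomp k (CoindModule k A V) X.nilEnd) = 1 := by
    ext1 h
    apply L.injective
    ext e
    change L.symm (L h ∘ₗ g ∘ₗ r) (X.ι (X.p e)) 1 +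
      L.symm (L (h ∘ₗ X.nilEnd) ∘ₗ g ∘ₗ r) e 1 = h e 1
    rw [hL, hL]
    change h (g (r (X.ι (X.p e)))) 1 + h (X.ι (X.p (g (r e)))) 1 = h e 1
    rw [hrι, hpg, hιr, ← CoindModule.add_apply, ← map_add, add_sub_cancel]
  have := finiteDimensional_hom k (A := A) (M := E) (N := CoindModule k A V)
  rw [homTrace, contractionTrace_eq (X.commute_homPostcomp k _) hσ]
  change LinearMap.trace k _ (homPostcomp k E (CoindModule.map ψ) ∘ₗ α ∘ₗ β) = 0
  rw [← LinearMap.comp_assoc, LinearMap.trace_comp_comm' β]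
  have h0 : β ∘ₗ homPostcomp k E (CoindModule.map ψ) ∘ₗ α = 0 := by
    ext f s
    change ψ (L.symm (f ∘ₗ r) (g s) 1) = 0
    rw [hL, LinearMap.comp_apply, hrg]
    simp
  rw [h0, _root_.map_zero]

/-- By A-linearity the endomorphism acts on Hom_A(E, N) as precomposition with ε, which factors
through Hom_A(S, N). Cyclicity turns the trace into that of the identity there. -/
theorem homTrace_mulEnd [FiniteDimensional k A] {a : A} (ha : ∀ e : E, a • e = X.nilEnd e) :
    X.homTrace k (CoindModule.mulEnd a : CoindModule k A V →ₗ[A] CoindModule k A V) =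
      Module.finrank k (S →ₗ[k] V) := by
  have hSfin : FiniteDimensional k S :=
    Module.Finite.of_injective (X.ι.restrictScalars k) X.ι_injective
  have := CoindModule.subsingleton_ext (k := k) (A := A) (V := V) S 0
  obtain ⟨σ, hσ⟩ := X.exists_contraction_hom k (N := CoindModule k A V)
  have := finiteDimensional_hom k (A := A) (M := E) (N := CoindModule k A V)
  have := finiteDimensional_hom k (A := A) (M := S) (N := CoindModule k A V)
  rw [homTrace, contractionTrace_eq (X.commute_homPostcomp k _) hσ]
  have h1 : homPostcomp k E (CoindModule.mulEnd a : CoindModule k A V →ₗ[A] CoindModule k A V) =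
      homPrecomp k _ X.p ∘ₗ homPrecomp k _ X.ι := by
    ext h e x
    change h e (a * x) = h (X.nilEnd e) x
    calc h e (a * x) = (a • (x • h e)) 1 := by simp
      _ = h (a • (x • e)) 1 := by rw [map_smul, map_smul]
      _ = h (X.nilEnd e) x := by rw [ha, map_smul, map_smul]; simp
  rw [h1]
  change LinearMap.trace k _ (homPrecomp k _ X.p ∘ₗ homPrecomp k _ X.ι ∘ₗ σ) = _
  rw [LinearMap.trace_comp_comm']
  -- Apply the contraction identity to hp, which ε kills because pι = 0, then cancel the surjection
  -- p.
  have h2 : (homPrecomp k _ X.ι ∘ₗ σ) ∘ₗ homPrecomp k (CoindModule k A V) X.p = LinearMap.id := by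
    ext1 h
    have h3 := LinearMap.congr_fun hσ (h ∘ₗ X.p)
    have h4 : homPrecomp k (CoindModule k A V) X.nilEnd (h ∘ₗ X.p) = 0 := by
      ext e
      simp [nilEnd, p_ι]
    rw [LinearMap.add_apply, Module.End.mul_apply, Module.End.mul_apply, h4, _root_.map_zero,
      add_zero] at h3
    ext1 s
    obtain ⟨e, rfl⟩ := X.p_surjective s
    exact LinearMap.congr_fun h3 e
  rw [h2, LinearMap.trace_id, (CoindModule.homEquiv S).finrank_eq]

end SelfExtension

/-! ### The trace extended to all modules by dimension shifting -/

namespace SelfExtension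

/-- The trace on the `d`-th cosyzygy, with sign. -/
noncomputable def cosyzygyTrace (k : Type u) [Field k] {A : Type v} [Ring A] [Algebra k A]
    {S E : Type v} [AddCommGroup S] [Module A S] [AddCommGroup E] [Module A E]
    (X : SelfExtension A S E) : (d : ℕ) → (N : Type v) → [AddCommGroup N] → [Module k N] →
      [Module A N] → [IsScalarTower k A N] → (N →ₗ[A] N) → k
  | 0, _, _, _, _, _, φ => X.homTrace k φ
  | d + 1, N, _, _, _, _, φ => -cosyzygyTrace k X d (Cosyzygy k A N) (Cosyzygy.map k φ)

variable (k : Type u) [Field k] {A : Type v} [Ring A] [Algebra k A]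
  {S E : Type v} [AddCommGroup S] [Module A S] [AddCommGroup E] [Module A E]
  (X : SelfExtension A S E)

theorem cosyzygyTrace_zero (d : ℕ) (N : Type v) [AddCommGroup N] [Module k N] [Module A N]
    [IsScalarTower k A N] : X.cosyzygyTrace k d N 0 = 0 := by
  induction d generalizing N with
  | zero => exact X.homTrace_zero k
  | succ d ih => rw [cosyzygyTrace, Cosyzygy.map_zero, ih, neg_zero]

/-- Vanishing of `Ext` in high degrees is improved by one on passing to the cosyzygy. -/
theorem _root_.Cosyzygy.subsingleton_ext (S N : Type v) [AddCommGroup S] [Module A S]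
    [AddCommGroup N] [Module k N] [Module A N] [IsScalarTower k A N] (n : ℕ)
    [Subsingleton (Ext (ModuleCat.of A S) (ModuleCat.of A N) (n + 2))] :
    Subsingleton (Ext (ModuleCat.of A S) (ModuleCat.of A (Cosyzygy k A N)) (n + 1)) := by
  have := CoindModule.subsingleton_ext (k := k) (A := A) (V := N) S n
  exact subsingleton_ext_of_exact_shift (CoindModule.unit_injective k A) (Cosyzygy.exact k A N)
    (Submodule.mkQ_surjective _) (n + 1)

variable [FiniteDimensional k A] [Module k E] [IsScalarTower k A E] [FiniteDimensional k E]

theorem cosyzygyTrace_add_of_exact (d : ℕ) {N N' N'' : Type v}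
    [AddCommGroup N] [Module k N] [Module A N] [IsScalarTower k A N] [FiniteDimensional k N]
    [AddCommGroup N'] [Module k N'] [Module A N'] [IsScalarTower k A N'] [FiniteDimensional k N']
    [AddCommGroup N''] [Module k N''] [Module A N''] [IsScalarTower k A N'']
    [FiniteDimensional k N''] {i : N' →ₗ[A] N} {q : N →ₗ[A] N''}
    (hi : Function.Injective i) (h : Function.Exact i q) (hq : Function.Surjective q)
    (hN' : Subsingleton (Ext (ModuleCat.of A S) (ModuleCat.of A N') (d + 1)))
    (hN'' : Subsingleton (Ext (ModuleCat.of A S) (ModuleCat.of A N'') (d + 1)))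
    {φ' : N' →ₗ[A] N'} {φ : N →ₗ[A] N} {φ'' : N'' →ₗ[A] N''}
    (hφi : φ ∘ₗ i = i ∘ₗ φ') (hφq : q ∘ₗ φ = φ'' ∘ₗ q) :
    X.cosyzygyTrace k d N φ = X.cosyzygyTrace k d N' φ' + X.cosyzygyTrace k d N'' φ'' := by
  induction d generalizing N N' N'' with
  | zero => exact X.homTrace_add_of_exact k hi h hq hφi hφq
  | succ d ih =>
    rw [cosyzygyTrace, cosyzygyTrace, cosyzygyTrace, ← neg_add]
    congr 1
    refine ih (Cosyzygy.map_injective k hi) (Cosyzygy.map_exact k hi h hq)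
      (Cosyzygy.map_surjective k hq) (Cosyzygy.subsingleton_ext k S N' d)
      (Cosyzygy.subsingleton_ext k S N'' d) ?_ ?_
    · rw [← Cosyzygy.map_comp, ← Cosyzygy.map_comp, hφi]
    · rw [← Cosyzygy.map_comp, ← Cosyzygy.map_comp, hφq]

/-- In the sequence embedding N in its coinduced module the middle trace is zero, so each passage to
the cosyzygy changes the sign of the trace. The sign in `cosyzygyTrace` compensates. -/
theorem cosyzygyTrace_eq_homTrace [Module k S] [IsScalarTower k A S] (d : ℕ) {N : Type v}
    [AddCommGroup N] [Module k N] [Module A N] [IsScalarTower k A N] [FiniteDimensional k N]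
    (hN : ∀ n, Subsingleton (Ext (ModuleCat.of A S) (ModuleCat.of A N) (n + 1)))
    (φ : N →ₗ[A] N) : X.cosyzygyTrace k d N φ = X.homTrace k φ := by
  induction d generalizing N with
  | zero => rfl
  | succ d ih =>
    have hC : ∀ n, Subsingleton (Ext (ModuleCat.of A S) (ModuleCat.of A (Cosyzygy k A N)) (n + 1)) :=
      fun n => have := hN (n + 1); Cosyzygy.subsingleton_ext k S N n
    have := hN 0
    have := hC 0
    have key := X.homTrace_add_of_exact k (φ' := φ)
      (φ := CoindModule.map (φ.restrictScalars k)) (φ'' := Cosyzygy.map k φ)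
      (CoindModule.unit_injective k A) (Cosyzygy.exact k A N) (Submodule.mkQ_surjective _)
      (by ext n x; simp) rfl
    rw [X.homTrace_coindModule_map k] at key
    rw [cosyzygyTrace, ih hC]
    exact neg_eq_of_add_eq_zero_left key.symm

/-- Additivity along ker φ ⊆ N: φ is zero on the kernel and has smaller nilpotency exponent on the
quotient. -/
theorem cosyzygyTrace_eq_zero_of_isNilpotent (d : ℕ)
    (hS : ∀ (N : Type v) [AddCommGroup N] [Module A N],
      Subsingleton (Ext (ModuleCat.of A S) (ModuleCat.of A N) (d + 1)))
    {N : Type v} [AddCommGroup N] [Module k N] [Module A N] [IsScalarTower k A N]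
    [FiniteDimensional k N] {φ : Module.End A N} (hφ : IsNilpotent φ) :
    X.cosyzygyTrace k d N φ = 0 := by
  obtain ⟨n, hn⟩ := hφ
  induction n generalizing N with
  | zero =>
    have : φ = 0 := by rw [← mul_one φ, ← pow_zero φ, hn, mul_zero]
    rw [this]
    exact X.cosyzygyTrace_zero k d N
  | succ n ih =>
    let K : Submodule A N := LinearMap.ker φ
    have : FiniteDimensional k K :=
      Module.Finite.of_injective (K.subtype.restrictScalars k) K.subtype_injective
    have : FiniteDimensional k (N ⧸ K) := Module.Finite.quotient k K
    let ψ : Module.End A (N ⧸ K) := K.mapQ K φ (fun x hx => by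
      have hx' : φ x = 0 := hx
      change φ (φ x) = 0
      rw [hx', map_zero])
    have hψ : ∀ (m : ℕ) (x : N), (ψ ^ m) (Submodule.Quotient.mk x) =
        Submodule.Quotient.mk ((φ ^ m) x) := by
      intro m x
      induction m with
      | zero => rfl
      | succ m ihm => rw [pow_succ', Module.End.mul_apply, ihm, pow_succ', Module.End.mul_apply]; rfl
    have hψn : ψ ^ n = 0 := by
      ext x
      change (ψ ^ n) (Submodule.Quotient.mk x) = 0
      rw [hψ, Submodule.Quotient.mk_eq_zero]
      change φ ((φ ^ n) x) = 0
      rw [← Module.End.mul_apply, ← pow_succ', hn, LinearMap.zero_apply]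
    rw [X.cosyzygyTrace_add_of_exact k d K.subtype_injective (LinearMap.exact_subtype_mkQ K)
      K.mkQ_surjective (hS K) (hS (N ⧸ K)) (φ' := 0) (φ := φ) (φ'' := ψ) ?_ rfl,
      X.cosyzygyTrace_zero k, ih hψn, add_zero]
    ext x
    exact x.2

/-- If `Ext^{d+1}(S, -)` vanishes and some nilpotent element acts on a self-extension of `S` as the
canonical square-zero endomorphism, then `dim Hom_k(S, V)` vanishes in `k`. -/
theorem finrank_hom_eq_zero [Module k S] [IsScalarTower k A S] (d : ℕ)
    (hS : ∀ (N : Type v) [AddCommGroup N] [Module A N],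
      Subsingleton (Ext (ModuleCat.of A S) (ModuleCat.of A N) (d + 1)))
    {a : A} (ha : IsNilpotent a) (haE : ∀ e : E, a • e = X.nilEnd e)
    (V : Type v) [AddCommGroup V] [Module k V] [FiniteDimensional k V] :
    (Module.finrank k (S →ₗ[k] V) : k) = 0 := by
  rw [← X.homTrace_mulEnd k haE, ← X.cosyzygyTrace_eq_homTrace k d
    (fun n => CoindModule.subsingleton_ext (k := k) S n)]
  exact X.cosyzygyTrace_eq_zero_of_isNilpotent k d hS (CoindModule.isNilpotent_mulEnd ha)

end SelfExtension

/-! ### Simple modules over elementary algebras and maps from left ideals -/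

section Elementary

variable {k : Type u} [Field k] {A : Type v} [Ring A] [Algebra k A]

/-- Over an elementary algebra every element acts on a simple module as a scalar. -/
theorem IsElementaryAlgebra.exists_smul_eq (hA : IsElementaryAlgebra k A) (S : Type v)
    [AddCommGroup S] [Module A S] [IsSimpleModule A S] [Module k S] [IsScalarTower k A S] (a : A) :
    ∃ c : k, ∀ s : S, a • s = c • s := by
  obtain ⟨n, ⟨Φ⟩⟩ := hA
  have hJ : ∀ x ∈ Ring.jacobson A, ∀ s : S, x • s = 0 := fun x hx =>
    Module.mem_annihilator.1 (IsSemisimpleModule.jacobson_le_annihilator A S hx)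
  let π : A →ₐ[k] (Fin n → k) := Φ.toAlgHom.comp (Ideal.Quotient.mkₐ k (Ring.jacobson A))
  have hπ : Function.Surjective π := Φ.surjective.comp Ideal.Quotient.mk_surjective
  have hπ0 : ∀ x y : A, π x = π y → ∀ s : S, x • s = y • s := by
    intro x y hxy s
    have h1 : Ideal.Quotient.mk (Ring.jacobson A) x = Ideal.Quotient.mk (Ring.jacobson A) y :=
      Φ.injective hxy
    rw [← sub_eq_zero, ← sub_smul]
    exact hJ _ (Ideal.Quotient.eq.1 h1) s
  choose e he using fun i : Fin n => hπ (Pi.single i 1)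
  -- The lifted idempotents sum to 1 modulo J, so some `e i` acts nontrivially on S. As A/J is
  -- commutative, its action is A-linear, hence injective by Schur.
  obtain ⟨i, s, his⟩ : ∃ i, ∃ s : S, e i • s ≠ 0 := by
    by_contra! hcon
    have : Nontrivial S := IsSimpleModule.nontrivial A S
    obtain ⟨s, hs⟩ := exists_ne (0 : S)
    refine hs ?_
    rw [← one_smul A s, hπ0 1 (∑ i, e i) (by
      rw [map_one, map_sum]; simp only [he]; exact (Finset.univ_sum_single 1).symm), Finset.sum_smul]
    exact Finset.sum_eq_zero fun i _ => hcon i s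
  let f : S →ₗ[A] S :=
    { toFun := fun s => e i • s
      map_add' := smul_add _
      map_smul' := fun x s => by
        rw [RingHom.id_apply, ← mul_smul, ← mul_smul]
        exact hπ0 _ _ (by rw [map_mul, map_mul, mul_comm]) s }
  have hf : Function.Injective f := by
    refine (LinearMap.injective_or_eq_zero f).resolve_right fun h0 => his ?_
    exact LinearMap.congr_fun h0 s
  refine ⟨π a i, fun s => hf ?_⟩
  change e i • a • s = e i • π a i • s
  rw [← mul_smul, ← algebraMap_smul A (π a i) s, ← mul_smul]
  refine hπ0 _ _ ?_ s
  rw [map_mul, map_mul, he, AlgHom.commutes]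
  ext j
  by_cases hj : j = i
  · subst hj; simp
  · simp [hj]

/-- A map to a module from a left ideal that vanishes on the Jacobson radical extends to the whole
ring. -/
theorem exists_extension_of_jacobson_le [IsSemiprimaryRing A] {S : Type v} [AddCommGroup S]
    [Module A S] {m : Submodule A A} (f : m →ₗ[A] S)
    (hf : ∀ x (hx : x ∈ m), x ∈ Ring.jacobson A → f ⟨x, hx⟩ = 0) :
    ∃ g : A →ₗ[A] S, g ∘ₗ m.subtype = f := by
  let J : Submodule A A := Ring.jacobson A
  -- The map factors through m/(m ∩ J), a submodule of the semisimple module A/J, from which maps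
  -- extend.
  have : IsSemisimpleModule A (A ⧸ J) := by
    have h : Module.IsTorsionBySet A (A ⧸ J) (Ring.jacobson A : Set A) := by
      rintro x ⟨r, hr⟩
      obtain ⟨y, rfl⟩ := Submodule.Quotient.mk_surjective _ x
      exact (Submodule.Quotient.mk_eq_zero J).2 (Ideal.mul_mem_right y (Ring.jacobson A) hr)
    let _ := h.module
    exact h.isSemisimpleModule_iff.1 inferInstance
  let K : Submodule A m := J.comap m.subtype
  let i : (m ⧸ K) →ₗ[A] (A ⧸ J) := K.mapQ J m.subtype le_rfl
  have hi : Function.Injective i := by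
    rw [← LinearMap.ker_eq_bot, Submodule.ker_mapQ, Submodule.mkQ_map_self]
  obtain ⟨g, hg⟩ := IsSemisimpleModule.extension_property i hi
    (K.liftQ f fun x hx => hf x x.2 hx)
  refine ⟨g ∘ₗ J.mkQ, ?_⟩
  ext x
  exact LinearMap.congr_fun hg (Submodule.Quotient.mk x)

end Elementary

/-! ### The self-extension attached to a map m → S -/

section Elementary

variable {k : Type u} [Field k] {A : Type v} [Ring A] [Algebra k A]

theorem IsElementaryAlgebra.finrank_eq_one (hA : IsElementaryAlgebra k A) (S : Type v)
    [AddCommGroup S] [Module A S] [IsSimpleModule A S] [Module k S] [IsScalarTower k A S] :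
    Module.finrank k S = 1 := by
  have : Nontrivial S := IsSimpleModule.nontrivial A S
  obtain ⟨s, hs⟩ := exists_ne (0 : S)
  refine (finrank_eq_one_iff_of_nonzero' s hs).2 fun t => ?_
  obtain ⟨x, rfl⟩ := IsSimpleModule.toSpanSingleton_surjective A hs t
  obtain ⟨c, hc⟩ := hA.exists_smul_eq S x
  exact ⟨c, (hc s).symm⟩

/-- Let `m` be the kernel of `q : A → S`. A map `f : m → S` and an element `a` of the radical with
`f a = q 1` give a self-extension of `S` with middle term `A ⧸ ker f`, on which `a` acts as the
canonical square-zero endomorphism. -/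
theorem IsElementaryAlgebra.exists_selfExtension (hA : IsElementaryAlgebra k A) {S : Type v}
    [AddCommGroup S] [Module A S] [IsSimpleModule A S] [Module k S] [IsScalarTower k A S]
    {q : A →ₗ[A] S} (hqs : Function.Surjective q) {m : Submodule A A}
    (hm : ∀ x, x ∈ m ↔ q x = 0) (f : m →ₗ[A] S) {a : A} (haJ : a ∈ Ring.jacobson A)
    (ham : a ∈ m) (hfa : f ⟨a, ham⟩ = q 1) :
    ∃ X : SelfExtension A S (A ⧸ (LinearMap.ker f).map m.subtype), ∀ e, a • e = X.nilEnd e := by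
  have hq : ∀ x, q x = x • q 1 := fun x => by rw [← map_smul, smul_eq_mul, mul_one]
  have hfs : Function.Surjective f := fun t => by
    obtain ⟨x, rfl⟩ := hqs t
    exact ⟨x • ⟨a, ham⟩, by rw [map_smul, hfa, ← hq]⟩
  let I : Submodule A A := (LinearMap.ker f).map m.subtype
  have hI : ∀ y : m, (y : A) ∈ I ↔ f y = 0 := by
    intro y
    constructor
    · rintro ⟨z, hz, hzy⟩
      rw [← Subtype.ext hzy]
      exact hz
    · exact fun hy => ⟨y, hy, rfl⟩
  have hIm : I ≤ LinearMap.ker q := by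
    rintro _ ⟨z, -, rfl⟩
    exact (hm _).1 z.2
  let ι₀ : (m ⧸ LinearMap.ker f) →ₗ[A] A ⧸ I :=
    (LinearMap.ker f).mapQ I m.subtype fun z hz => (hI z).2 hz
  let ι : S →ₗ[A] A ⧸ I := ι₀ ∘ₗ (f.quotKerEquivOfSurjective hfs).symm.toLinearMap
  have hι : ∀ y : m, ι (f y) = Submodule.Quotient.mk (y : A) := by
    intro y
    have : (f.quotKerEquivOfSurjective hfs).symm (f y) = Submodule.Quotient.mk y := by
      rw [LinearEquiv.symm_apply_eq]; rfl
    simp only [ι, LinearMap.comp_apply, LinearEquiv.coe_coe, this]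
    rfl
  let p : (A ⧸ I) →ₗ[A] S := I.liftQ q hIm
  refine ⟨⟨ι, p, ?_, ?_, ?_⟩, ?_⟩
  · rw [injective_iff_map_eq_zero]
    intro t ht
    obtain ⟨y, rfl⟩ := hfs t
    rw [hι, Submodule.Quotient.mk_eq_zero] at ht
    exact (hI y).1 ht
  · intro e
    constructor
    · intro he
      obtain ⟨x, rfl⟩ := Submodule.Quotient.mk_surjective _ e
      exact ⟨f ⟨x, (hm x).2 he⟩, hι _⟩
    · rintro ⟨t, rfl⟩
      obtain ⟨y, rfl⟩ := hfs t
      rw [hι]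
      exact (hm _).1 y.2
  · intro t
    obtain ⟨x, rfl⟩ := hqs t
    exact ⟨Submodule.Quotient.mk x, rfl⟩
  · intro e
    obtain ⟨x, rfl⟩ := Submodule.Quotient.mk_surjective _ e
    have haS : ∀ t : S, a • t = 0 :=
      Module.mem_annihilator.1 (IsSemisimpleModule.jacobson_le_annihilator A S haJ)
    -- Since f(xa) = x • q 1 = q x, the endomorphism ε sends the class of x to that of xa. It
    -- remains to see f(ax - xa) = 0: write x = c + y with c a scalar and y in m; then f(ay) = a •
    -- f(y) = 0 as a is in J, and f(ca) = f(xa).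
    obtain ⟨c, hc⟩ := hA.exists_smul_eq S x
    have hxm : x - algebraMap k A c ∈ m := by
      rw [hm, hq, sub_smul, hc, algebraMap_smul, sub_self]
    have h1 : ι (q x) = Submodule.Quotient.mk (x * a) := by
      have : q x = f (x • ⟨a, ham⟩) := by rw [map_smul, hfa, ← hq]
      rw [this, hι]
      rfl
    change Submodule.Quotient.mk (a * x) = ι (q x)
    rw [h1, Submodule.Quotient.eq]
    have h2 : a * x - x * a = ((a • ⟨x - algebraMap k A c, hxm⟩ + algebraMap k A c • ⟨a, ham⟩ -
        x • ⟨a, ham⟩ : m) : A) := by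
      simp [mul_sub, Algebra.smul_def, Algebra.commutes c a]
    rw [h2]
    refine (hI _).2 ?_
    rw [map_sub, map_add, map_smul, map_smul, map_smul, haS, hfa, hc, algebraMap_smul, zero_add,
      sub_self]

end Elementary

/-! ### The no-loop theorem -/

theorem theorem2 (k : Type u) [Field k] (A : Type v) [Ring A] [Algebra k A]
    [FiniteDimensional k A] (hA : IsElementaryAlgebra k A)
    (S : Type v) [AddCommGroup S] [Module A S] [IsSimpleModule A S]
    (hS : CategoryTheory.projectiveDimension (ModuleCat.of A S) < ⊤) :
    Subsingleton (CategoryTheory.Abelian.Ext (ModuleCat.of A S) (ModuleCat.of A S) 1) := by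
  let _ : Module k S := Module.compHom S (algebraMap k A)
  have : IsScalarTower k A S := ⟨fun c a s => by
    rw [Algebra.smul_def, mul_smul]; rfl⟩
  have : IsArtinianRing A := IsArtinianRing.of_finite k A
  obtain ⟨d, hd⟩ := (projectiveDimension_ne_top_iff _).1 hS.ne
  have hExt : ∀ (N : Type v) [AddCommGroup N] [Module A N],
      Subsingleton (Ext (ModuleCat.of A S) (ModuleCat.of A N) (d + 1)) := fun N _ _ =>
    HasProjectiveDimensionLT.subsingleton (ModuleCat.of A S) (d + 1) (d + 1) le_rfl _
  have : Nontrivial S := IsSimpleModule.nontrivial A S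
  obtain ⟨s, hs⟩ := exists_ne (0 : S)
  refine subsingleton_ext_one_of_forall_extension (Submodule.subtype_injective _)
    (LinearMap.exact_subtype_ker_map (LinearMap.toSpanSingleton A S s))
    (IsSimpleModule.toSpanSingleton_surjective A hs) fun f => ?_
  by_contra hf
  -- A map that does not extend to A is nonzero on some radical element x of the kernel. As S is
  -- simple, a left multiple of x maps to s.
  obtain ⟨a, ham, haJ, hfa⟩ : ∃ a, ∃ ham : a ∈ LinearMap.ker (LinearMap.toSpanSingleton A S s),
      a ∈ Ring.jacobson A ∧ f ⟨a, ham⟩ = s := by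
    by_contra! hcon
    refine hf (exists_extension_of_jacobson_le f fun x hx hxJ => ?_)
    by_contra hfx
    obtain ⟨y, hy⟩ := IsSimpleModule.toSpanSingleton_surjective A hfx s
    refine hcon (y * x) (Submodule.smul_mem _ y hx) (Ideal.mul_mem_left _ y hxJ) ?_
    exact (map_smul f y ⟨x, hx⟩).trans hy
  obtain ⟨X, hX⟩ := hA.exists_selfExtension
    (IsSimpleModule.toSpanSingleton_surjective A hs) (fun _ => Iff.rfl) f haJ ham
    (hfa.trans (one_smul A s).symm)
  have hnil : IsNilpotent a := by
    obtain ⟨n, hn⟩ := IsSemiprimaryRing.isNilpotent (R := A)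
    exact ⟨n, by simpa [hn] using Ideal.pow_mem_pow haJ n⟩
  have h1 := hA.finrank_eq_one S
  have : FiniteDimensional k S := Module.finite_of_finrank_eq_succ h1
  have h0 := X.finrank_hom_eq_zero k d hExt hnil hX S
  rw [Module.finrank_linearMap, h1] at h0
  simp at h0
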